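/- **Setting.** Let $\Sigma$ be a finite totally ordered alphabet containing two distinct letters $0,1$, let $W=\Sigma^*$ (the empty word is $\epsilon$), and let $V$ be an infinite set of variables. Let $O$ be a set of operators; each $op\in O$ has a fixed arity $ar(op)$ and a total semantics $[\![op]\!]:W^{ar(op)}\to W$. $O$ includes at least $=,<,\le$ (shortlex order), the constant $0$, $+1,-1$ on unary numbers ($1^n\mapsto 1^{n+1}$, resp. $1^{n+1}\mapsto 1^n$, and $\epsilon$ on all other inputs), and $not, and, or$; predicates return the word $1$ (true) or $0$ (false), and a truth value is true iff it is the word $1$. **Programs.** Expressions are $e ::= x \mid op(\bar e)\mid declass(e,e)$; statements are $s ::= skip \mid x:=e\mid s;s\mid if(e)\{s\}else\{s\}\mid while(e)\{s\}\mid break(e)$; a program is $P=prog(\bar x)\{s\ return\ y\}$, with body $s$, where $break$ occurs only inside $while$ loops. A store is a map $\mu:V\to W$. Expressions are evaluated in $\mu$ as usual, $declass(e_1,e_2)$ having value $1^{\min(|w_1|,|w_2|)}$ when $e_i$ has value $w_i$. Statements have the usual big-step semantics $(\mu,s)\to(\square,\mu')$ with a flag $\square\in\{\top,\bot\}$: $break(e)$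 returns $(\bot,\mu)$ if $e$ is true and $(\top,\mu)$ otherwise; if $s_1$ returns $(\bot,\mu')$ then so does $s_1;s_2$; if $e$ is true in $\mu$ then $(\mu,while(e)\{s\})$ evaluates $(\mu,\ s;while(e)\{s\})$ and, if that returns $(\square,\mu')$, returns $(\top,\mu')$; if $e$ is false it returns $(\top,\mu)$. $P$ computes the partial function $[\![P]\!]:W^{\ell(\bar x)}\rightharpoonup W$ with $[\![P]\!](\bar w)=v$ iff $(\mu_\emptyset[\bar x\leftarrow\bar w],s)\to(\top,\mu')$ for some $\mu'$ with $\mu'(y)=v$, where $\mu_\emptyset$ is constantly $\epsilon$. $P$ is *terminating* if $[\![P]\!]$ is total; $\mathrm{TERM}$ is the set of terminating programs. For a set $S$ of programs, $[\![S]\!]=\{[\![P]\!]\mid P\in S\}$. **Safety.** Levels are natural numbers. An operator $op$ of arity $k$ is *neutral* if $[\![op]\!]$ takes only the values $0,1$, or if for some fixed $i\le k$ the word $[\![op]\!](\bar w)$ is always a contiguous sub-word of $w_i$; *positive* if $|[\![op]\!](\bar w)|\le\max_i|w_i|+c$ for a constant $c$; *polynomial* if $|[\![op]\!](\bar w)|\le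 Q(\max_i|w_i|)$ for a polynomial $Q\in\mathbb N[X]$. A variable environment $\Gamma$ is a finite partial map $V\to\mathbb N$. An operator environment $\Delta$ gives for each $op$ a finite partial map sending $(i,j)\in\mathbb N^2$ to a set of admissible tuples $\tau_1\to\dots\to\tau_k\to\tau$ of levels. $\Delta$ is *safe* if each operator in its domain is neutral, positive or polynomial and polynomial-time computable, and for each tuple in $\Delta(op)(i,j)$: if $op$ is neutral, $\tau\le\tau_n$ for all $n$; if $op$ is positive and not neutral, $\tau\le\tau_n$ for all $n$, and $\tau<i$ or $\tau=0$; if $op$ is polynomial and not positive, $j=0$. Judgments $\Gamma,\Delta\vdash^{i}_{j}b:\tau$ ($i$ innermost level, $j$ outermost level) are generated by: - $x:\Gamma(x)$; $op(\bar e):\tau$ if $e_n:\tau_n$ for all $n$ and $\tau_1\to\dots\to\tau_k\to\tau\in\Delta(op)(i,j)$; $declass(e_1,e_2):\tau$ if $e_1:\tau_1$, $e_2:j$ and $\tau_1\le\tau\le j$; - $skip:0$; from $s:\tau_1$ and $\tau_1\le\tau_2$ infer $s:\tau_2$; $(x:=e):\Gamma(x)$ if $e:\tau_2$ and ($j=0$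 or $\Gamma(x)\le\tau_2$); $s_1;s_2:\tau$ if $s_1:\tau$ and $s_2:\tau$; $if(e)\{s_1\}else\{s_0\}:\tau$ if $e,s_1,s_0:\tau$; $break(e):i$ if $e:\tau$ and $i\le\tau$; - $\vdash^{i}_{j}while(e)\{s\}:\tau$ if $\vdash^{\tau}_{j}e:\tau$, $\vdash^{\tau}_{j}s:\tau$ and $1\le\tau\le j$; $\vdash^{0}_{0}while(e)\{s\}:\tau$ if $\vdash^{\tau}_{\tau}e:\tau$, $\vdash^{\tau}_{\tau}s:\tau$ and $1\le\tau$. $\mathrm{SAFE}$ is the set of programs $P$ for which there are a safe $\Delta$, a $\Gamma$ and a $\tau$ with $\Gamma,\Delta\vdash^0_0 body(P):\tau$. **Aperiodicity.** Let $U(x)=\{x\}$, $U(op(\bar e))=\bigcup_n U(e_n)$, $U(declass(e_1,e_2))=U(e_2)$, and let $\mu\equiv_e\mu'$ mean that $\mu,\mu'$ agree on $U(e)$. Let $\pi_c$ be the (possibly infinite) evaluation tree of a configuration $c$. $P$ is *aperiodic* ($P\in\mathrm{AP}$) if for no store $\mu$ does $\pi_{(\mu,body(P))}$ have subtrees $\pi_{(\mu',s')}$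 and $\pi_{(\mu'',s')}$ with $s'=while(e)\{s''\}$, the second occurring strictly below the root of the first, and $\mu'\equiv_e\mu''$. **Corollary (Termination).** Every safe and aperiodic program is terminating, i.e. $\mathrm{SAFE}\cap\mathrm{AP}\subseteq\mathrm{TERM}$, and $[\![\mathrm{SAFE}\cap\mathrm{AP}]\!]\subsetneq[\![\mathrm{TERM}]\!]$. -/

import Mathlib

/-!
A first-order imperative language with `while`, `break` and a length-declassification construct,
its big-step semantics, its level-based type system, safety, aperiodicity, computed functions.
The letters `0` and `1` of the alphabet `A` are Lean's `(0 : A)` and `(1 : A)`.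
-/

namespace Declass

/-- Words, also called values. -/
abbrev Word (A : Type) : Type := List A

/-! ### Operators -/

/-- A set of operator symbols, each with a fixed arity and a total function on words. -/
structure OpSet (A : Type) where
  Op : Type
  ar : Op → ℕ
  sem : (o : Op) → (Fin (ar o) → Word A) → Word A

/-- A word is a unary number `1ⁿ` when all its letters are `1`. -/
def IsUnary {A : Type} [One A] (w : Word A) : Prop := ∀ a ∈ w, a = 1

/-- The word of a truth value: the one-letter word `1` (true) or `0` (false). -/
noncomputable def boolWord {A : Type} [Zero A] [One A] (p : Prop) : Word A :=
  open scoped Classical in if p then [1] else [0]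

/-- Increment of unary numbers; the empty word on all other inputs. -/
noncomputable def unarySucc {A : Type} [One A] (w : Word A) : Word A :=
  open scoped Classical in if IsUnary w then 1 :: w else []

/-- Decrement of unary numbers; the empty word on all other inputs (and on the empty word). -/
noncomputable def unaryPred {A : Type} [One A] (w : Word A) : Word A :=
  open scoped Classical in if IsUnary w then w.tail else []

/-- The standard shortlex order on words. -/
def wordLT {A : Type} [LinearOrder A] (v w : Word A) : Prop := List.Shortlex (· < ·) v w

/-- Some symbol of `O` has arity `k` and computes `f`. -/
def OpSet.Has {A : Type} (O : OpSet A) (k : ℕ) (f : (Fin k → Word A) → Word A) : Prop :=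
  ∃ (o : O.Op) (h : O.ar o = k), ∀ w : Fin k → Word A, O.sem o (fun i => w (Fin.cast h i)) = f w

/-- `O` includes the basic operators `=, <, ≤, 0, +1, -1, not, and, or`. A truth value argument is
true when it is the word `1`, and false otherwise. -/
structure OpSet.IncludesBasic {A : Type} [LinearOrder A] [Zero A] [One A] (O : OpSet A) :
    Prop where
  eq : O.Has 2 fun w => boolWord (w 0 = w 1)
  lt : O.Has 2 fun w => boolWord (wordLT (w 0) (w 1))
  le : O.Has 2 fun w => boolWord (wordLT (w 0) (w 1) ∨ w 0 = w 1)
  zero : O.Has 0 fun _ => [0]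
  succ : O.Has 1 fun w => unarySucc (w 0)
  pred : O.Has 1 fun w => unaryPred (w 0)
  not : O.Has 1 fun w => boolWord (w 0 ≠ [1])
  and : O.Has 2 fun w => boolWord (w 0 = [1] ∧ w 1 = [1])
  or : O.Has 2 fun w => boolWord (w 0 = [1] ∨ w 1 = [1])

/-- The largest length of the arguments (`0` if there is no argument). -/
def maxLen {A : Type} {k : ℕ} (w : Fin k → Word A) : ℕ :=
  Finset.univ.sup fun i => (w i).length

/-- Neutral: a predicate, or always a (contiguous) sub-word of one fixed argument. -/
def IsNeutral {A : Type} [Zero A] [One A] {k : ℕ} (f : (Fin k → Word A) → Word A) : Prop :=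
  (∀ w, f w = [0] ∨ f w = [1]) ∨ ∃ i : Fin k, ∀ w, f w <:+: w i

/-- Positive: the output is longer than the longest argument by at most a constant. -/
def IsPositive {A : Type} {k : ℕ} (f : (Fin k → Word A) → Word A) : Prop :=
  ∃ c : ℕ, ∀ w, (f w).length ≤ maxLen w + c

/-- Polynomial: the length of the output is polynomially bounded. -/
def IsPolynomial {A : Type} {k : ℕ} (f : (Fin k → Word A) → Word A) : Prop :=
  ∃ p : Polynomial ℕ, ∀ w, (f w).length ≤ p.eval (maxLen w)

/-- The input tape of a `k`-tuple of words: each word is followed by the separator `none`. -/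
def encodeTuple {A : Type} {k : ℕ} (w : Fin k → Word A) : List (Option A) :=
  (List.ofFn fun i => (w i).map some ++ [none]).flatten

/-- Computability by a multi-tape (multi-stack) Turing machine in polynomial time. -/
def IsPolyTime {A : Type} {k : ℕ} (f : (Fin k → Word A) → Word A) : Prop :=
  Nonempty (Turing.TM2ComputableInPolyTime (encodeTuple (A := A) (k := k)) (fun v : Word A => v) f)

/-! ### Syntax -/

inductive Expr (V : Type) {A : Type} (O : OpSet A) : Type
  | var (x : V) : Expr V O
  | op (o : O.Op) (args : Fin (O.ar o) → Expr V O) : Expr V O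
  | declass (e₁ e₂ : Expr V O) : Expr V O

inductive Stmt (V : Type) {A : Type} (O : OpSet A) : Type
  | skip : Stmt V O
  | assign (x : V) (e : Expr V O) : Stmt V O
  | seq (s₁ s₂ : Stmt V O) : Stmt V O
  | ite (e : Expr V O) (s₁ s₀ : Stmt V O) : Stmt V O
  | while (e : Expr V O) (s : Stmt V O) : Stmt V O
  | break (e : Expr V O) : Stmt V O

/-- No `break` occurs outside of the bodies of `while` loops. -/
def Stmt.BreaksInLoops {V A : Type} {O : OpSet A} : Stmt V O → Prop
  | .skip => True
  | .assign _ _ => True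
  | .seq s₁ s₂ => s₁.BreaksInLoops ∧ s₂.BreaksInLoops
  | .ite _ s₁ s₀ => s₁.BreaksInLoops ∧ s₀.BreaksInLoops
  | .while _ _ => True
  | .break _ => False

/-- A program `prog(params){body return out}`; as usual, `break` may occur only inside loops. -/
structure Program (V : Type) {A : Type} (O : OpSet A) where
  params : List V
  body : Stmt V O
  out : V
  breaks_in_loops : body.BreaksInLoops

/-! ### Semantics -/

/-- Memory stores. -/
abbrev Store (V A : Type) : Type := V → Word A

/-- The value of an expression in a store. -/
def Expr.eval {V A : Type} [One A] {O : OpSet A} (μ : Store V A) : Expr V O → Word A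
  | .var x => μ x
  | .op o args => O.sem o fun i => (args i).eval μ
  | .declass e₁ e₂ => List.replicate (min (e₁.eval μ).length (e₂.eval μ).length) 1

/-- The flag returned by a statement: `top` for normal completion, `bot` when the flow is to be
broken. -/
inductive Flag : Type
  | top
  | bot

/-- Big-step semantics: `Exec μ s b μ'` is `(μ, s) → (b, μ')`. A guard is true when its value is
the word `1` and false otherwise. -/
inductive Exec {V A : Type} [DecidableEq V] [One A] {O : OpSet A} :
    Store V A → Stmt V O → Flag → Store V A → Prop
  | skip (μ : Store V A) : Exec μ .skip .top μ
  | assign (μ : Store V A) (x : V) (e : Expr V O) :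
      Exec μ (.assign x e) .top (Function.update μ x (e.eval μ))
  | seq {μ μ' μ'' : Store V A} {s₁ s₂ : Stmt V O} {b : Flag} :
      Exec μ s₁ .top μ' → Exec μ' s₂ b μ'' → Exec μ (.seq s₁ s₂) b μ''
  | seqBreak {μ μ' : Store V A} {s₁ s₂ : Stmt V O} :
      Exec μ s₁ .bot μ' → Exec μ (.seq s₁ s₂) .bot μ'
  | iteTrue {μ μ' : Store V A} {e : Expr V O} {s₁ s₀ : Stmt V O} {b : Flag} :
      e.eval μ = [1] → Exec μ s₁ b μ' → Exec μ (.ite e s₁ s₀) b μ'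
  | iteFalse {μ μ' : Store V A} {e : Expr V O} {s₁ s₀ : Stmt V O} {b : Flag} :
      e.eval μ ≠ [1] → Exec μ s₀ b μ' → Exec μ (.ite e s₁ s₀) b μ'
  | whileFalse {μ : Store V A} {e : Expr V O} {s : Stmt V O} :
      e.eval μ ≠ [1] → Exec μ (.while e s) .top μ
  | whileTrue {μ μ' : Store V A} {e : Expr V O} {s : Stmt V O} {b : Flag} :
      e.eval μ = [1] → Exec μ (.seq s (.while e s)) b μ' → Exec μ (.while e s) .top μ'
  | breakFalse {μ : Store V A} {e : Expr V O} :
      e.eval μ ≠ [1] → Exec μ (.break e) .top μ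
  | breakTrue {μ : Store V A} {e : Expr V O} :
      e.eval μ = [1] → Exec μ (.break e) .bot μ

/-- The semantics is deterministic. -/
theorem Exec.unique {V A : Type} [DecidableEq V] [One A] {O : OpSet A} {μ : Store V A}
    {s : Stmt V O} {b : Flag} {μ' : Store V A} (h : Exec μ s b μ') :
    ∀ {c : Flag} {μ'' : Store V A}, Exec μ s c μ'' → b = c ∧ μ' = μ'' := by
  induction h with
  | skip => intro c ν h; cases h; exact ⟨rfl, rfl⟩
  | assign => intro c ν h; cases h; exact ⟨rfl, rfl⟩
  | seq h₁ h₂ ih₁ ih₂ =>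
    intro c ν h
    cases h with
    | seq k₁ k₂ => obtain ⟨_, rfl⟩ := ih₁ k₁; exact ih₂ k₂
    | seqBreak k₁ => exact absurd (ih₁ k₁).1 (by simp)
  | seqBreak h₁ ih₁ =>
    intro c ν h
    cases h with
    | seq k₁ k₂ => exact absurd (ih₁ k₁).1 (by simp)
    | seqBreak k₁ => exact ih₁ k₁
  | iteTrue he h₁ ih =>
    intro c ν h
    cases h with
    | iteTrue _ k => exact ih k
    | iteFalse ke _ => exact absurd he ke
  | iteFalse he h₁ ih =>
    intro c ν h
    cases h with
    | iteTrue ke _ => exact absurd ke he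
    | iteFalse _ k => exact ih k
  | whileFalse he =>
    intro c ν h
    cases h with
    | whileFalse _ => exact ⟨rfl, rfl⟩
    | whileTrue ke _ => exact absurd ke he
  | whileTrue he h₁ ih =>
    intro c ν h
    cases h with
    | whileFalse ke => exact absurd he ke
    | whileTrue _ k => exact ⟨rfl, (ih k).2⟩
  | breakFalse he =>
    intro c ν h
    cases h with
    | breakFalse _ => exact ⟨rfl, rfl⟩
    | breakTrue ke => exact absurd ke he
  | breakTrue he =>
    intro c ν h
    cases h with
    | breakFalse ke => exact absurd he ke
    | breakTrue _ => exact ⟨rfl, rfl⟩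

/-- The store `μ[x̄ ← w̄]`. -/
def Store.updates {V A : Type} [DecidableEq V] :
    (xs : List V) → (Fin xs.length → Word A) → Store V A → Store V A
  | [], _, μ => μ
  | x :: xs, w, μ => Store.updates xs (fun i => w i.succ) (Function.update μ x (w 0))

/-- The empty store. -/
def Store.empty (V A : Type) : Store V A := fun _ => []

/-- Running the program on the inputs `w` ends normally and returns `v`. -/
def Program.Returns {V A : Type} [DecidableEq V] [One A] {O : OpSet A} (P : Program V O)
    (w : Fin P.params.length → Word A) (v : Word A) : Prop :=
  ∃ μ' : Store V A, Exec (Store.updates P.params w (Store.empty V A)) P.body .top μ' ∧ μ' P.out = v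

/-- The partial function computed by a program. -/
noncomputable def Program.sem {V A : Type} [DecidableEq V] [One A] {O : OpSet A}
    (P : Program V O) : (Fin P.params.length → Word A) →. Word A :=
  fun w => ⟨∃ v, P.Returns w v, fun h => h.choose⟩

theorem Program.mem_sem_iff {V A : Type} [DecidableEq V] [One A] {O : OpSet A}
    (P : Program V O) (w : Fin P.params.length → Word A) (v : Word A) :
    v ∈ P.sem w ↔ P.Returns w v := by
  constructor
  · rintro ⟨h, rfl⟩
    exact h.choose_spec
  · intro h
    refine ⟨⟨v, h⟩, ?_⟩
    have hc : P.Returns w (Exists.choose (⟨v, h⟩ : ∃ v, P.Returns w v)) := Exists.choose_spec _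
    obtain ⟨μ₂, h₂, h₃⟩ := hc
    obtain ⟨μ₁, h₁, h₄⟩ := h
    exact h₃.symm.trans ((congrFun (h₁.unique h₂).2 P.out).symm.trans h₄)

/-- A program is terminating when its function is total. -/
def TERM (V : Type) {A : Type} [DecidableEq V] [One A] (O : OpSet A) : Set (Program V O) :=
  {P | ∀ w, (P.sem w).Dom}

/-- The set of functions (of any arity) computed by the programs of a set. -/
def functionsOf {V A : Type} [DecidableEq V] [One A] {O : OpSet A} (S : Set (Program V O)) :
    Set (Σ k : ℕ, (Fin k → Word A) →. Word A) :=
  (fun P : Program V O => ⟨P.params.length, P.sem⟩) '' S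

/-! ### Levels, type system, safety -/

/-- A variable typing environment: a finite map from variables to levels. -/
structure VarEnv (V : Type) where
  level : V → Option ℕ
  finite_dom : {x | level x ≠ none}.Finite

/-- An operator typing environment. `adm o i j` is the set of functional levels
`τ₁ → ⋯ → τₖ → τ`, written `((τ₁, …, τₖ), τ)`, that are admissible for `o` under innermost level `i`
and outermost level `j`; it is empty where the finite map is not defined. -/
structure OpEnv {A : Type} (O : OpSet A) where
  adm : (o : O.Op) → ℕ → ℕ → Set ((Fin (O.ar o) → ℕ) × ℕ)
  finite_dom : ∀ o, {p : ℕ × ℕ | (adm o p.1 p.2).Nonempty}.Finite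

/-- The operators that have at least one admissible functional level. -/
def OpEnv.dom {A : Type} {O : OpSet A} (Δ : OpEnv O) : Set O.Op :=
  {o | ∃ i j, (Δ.adm o i j).Nonempty}

/-- `HasLevel Γ Δ i j e τ`: under innermost level `i` and outermost level `j`, `e` has level `τ`. -/
inductive Expr.HasLevel {V A : Type} {O : OpSet A} (Γ : VarEnv V) (Δ : OpEnv O) (i j : ℕ) :
    Expr V O → ℕ → Prop
  | var {x : V} {τ : ℕ} : Γ.level x = some τ → HasLevel Γ Δ i j (.var x) τ
  | op {o : O.Op} {args : Fin (O.ar o) → Expr V O} {τs : Fin (O.ar o) → ℕ} {τ : ℕ} :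
      (τs, τ) ∈ Δ.adm o i j → (∀ n, HasLevel Γ Δ i j (args n) (τs n)) →
      HasLevel Γ Δ i j (.op o args) τ
  | declass {e₁ e₂ : Expr V O} {τ₁ τ : ℕ} :
      HasLevel Γ Δ i j e₁ τ₁ → HasLevel Γ Δ i j e₂ j → τ₁ ≤ τ → τ ≤ j →
      HasLevel Γ Δ i j (.declass e₁ e₂) τ

/-- `HasLevel Γ Δ i j s τ`: under innermost level `i` and outermost level `j`, `s` has level `τ`. -/
inductive Stmt.HasLevel {V A : Type} {O : OpSet A} (Γ : VarEnv V) (Δ : OpEnv O) :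
    ℕ → ℕ → Stmt V O → ℕ → Prop
  | sub {i j τ₁ τ₂ : ℕ} {s : Stmt V O} :
      HasLevel Γ Δ i j s τ₁ → τ₁ ≤ τ₂ → HasLevel Γ Δ i j s τ₂
  | skip {i j : ℕ} : HasLevel Γ Δ i j .skip 0
  | assign {i j τ₁ τ₂ : ℕ} {x : V} {e : Expr V O} :
      Γ.level x = some τ₁ → e.HasLevel Γ Δ i j τ₂ → (j = 0 ∨ τ₁ ≤ τ₂) →
      HasLevel Γ Δ i j (.assign x e) τ₁
  | seq {i j τ : ℕ} {s₁ s₂ : Stmt V O} :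
      HasLevel Γ Δ i j s₁ τ → HasLevel Γ Δ i j s₂ τ → HasLevel Γ Δ i j (.seq s₁ s₂) τ
  | ite {i j τ : ℕ} {e : Expr V O} {s₁ s₀ : Stmt V O} :
      e.HasLevel Γ Δ i j τ → HasLevel Γ Δ i j s₁ τ → HasLevel Γ Δ i j s₀ τ →
      HasLevel Γ Δ i j (.ite e s₁ s₀) τ
  | whileInner {i j τ : ℕ} {e : Expr V O} {s : Stmt V O} :
      e.HasLevel Γ Δ τ j τ → HasLevel Γ Δ τ j s τ → 1 ≤ τ → τ ≤ j →
      HasLevel Γ Δ i j (.while e s) τ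
  | whileOuter {τ : ℕ} {e : Expr V O} {s : Stmt V O} :
      e.HasLevel Γ Δ τ τ τ → HasLevel Γ Δ τ τ s τ → 1 ≤ τ →
      HasLevel Γ Δ 0 0 (.while e s) τ
  | break {i j τ : ℕ} {e : Expr V O} :
      e.HasLevel Γ Δ i j τ → i ≤ τ → HasLevel Γ Δ i j (.break e) i

/-- Safe operator typing environments. -/
def OpEnv.IsSafe {A : Type} [Zero A] [One A] {O : OpSet A} (Δ : OpEnv O) : Prop :=
  ∀ o ∈ Δ.dom,
    (IsNeutral (O.sem o) ∨ IsPositive (O.sem o) ∨ IsPolynomial (O.sem o)) ∧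
    IsPolyTime (O.sem o) ∧
    ∀ (i j : ℕ) (τs : Fin (O.ar o) → ℕ) (τ : ℕ), (τs, τ) ∈ Δ.adm o i j →
      (IsNeutral (O.sem o) → ∀ n, τ ≤ τs n) ∧
      (IsPositive (O.sem o) → ¬ IsNeutral (O.sem o) → (∀ n, τ ≤ τs n) ∧ (τ < i ∨ τ = 0)) ∧
      (IsPolynomial (O.sem o) → ¬ IsPositive (O.sem o) → j = 0)

/-- Safe programs. -/
def SAFE (V : Type) {A : Type} [Zero A] [One A] (O : OpSet A) : Set (Program V O) :=
  {P | ∃ Δ : OpEnv O, Δ.IsSafe ∧ ∃ (τ : ℕ) (Γ : VarEnv V), P.body.HasLevel Γ Δ 0 0 τ}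

/-! ### Aperiodicity -/

/-- Undeclassified variables of an expression. -/
def Expr.undeclassified {V A : Type} {O : OpSet A} : Expr V O → Set V
  | .var x => {x}
  | .op _ args => ⋃ i, (args i).undeclassified
  | .declass _ e₂ => e₂.undeclassified

/-- `e`-equivalence of stores. -/
def Expr.StoreEquiv {V A : Type} {O : OpSet A} (e : Expr V O) (μ μ' : Store V A) : Prop :=
  ∀ x ∈ e.undeclassified, μ x = μ' x

/-- `Child c c'`: in the (possibly infinite) evaluation tree with root `c`, the configuration `c'`
is the root of an immediate subtree, that is, evaluating `c` by the semantic rules calls for the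
evaluation of `c'`. The second component of a sequence is evaluated only once the first one has
ended normally. (Subtrees rooted at expressions contain no statement, hence are left out.) -/
inductive Child {V A : Type} [DecidableEq V] [One A] {O : OpSet A} :
    Store V A × Stmt V O → Store V A × Stmt V O → Prop
  | seqLeft {μ : Store V A} {s₁ s₂ : Stmt V O} : Child (μ, .seq s₁ s₂) (μ, s₁)
  | seqRight {μ μ' : Store V A} {s₁ s₂ : Stmt V O} :
      Exec μ s₁ .top μ' → Child (μ, .seq s₁ s₂) (μ', s₂)
  | iteTrue {μ : Store V A} {e : Expr V O} {s₁ s₀ : Stmt V O} :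
      e.eval μ = [1] → Child (μ, .ite e s₁ s₀) (μ, s₁)
  | iteFalse {μ : Store V A} {e : Expr V O} {s₁ s₀ : Stmt V O} :
      e.eval μ ≠ [1] → Child (μ, .ite e s₁ s₀) (μ, s₀)
  | while {μ : Store V A} {e : Expr V O} {s : Stmt V O} :
      e.eval μ = [1] → Child (μ, .while e s) (μ, .seq s (.while e s))

/-- `Subtree c c'`: the evaluation tree of `c` occurs as a subtree in the one of `c'`. -/
def Subtree {V A : Type} [DecidableEq V] [One A] {O : OpSet A} (c c' : Store V A × Stmt V O) :
    Prop :=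
  Relation.ReflTransGen Child c' c

/-- `StrictSubtree c c'`: the evaluation tree of `c` occurs strictly below the root in the one of
`c'`. -/
def StrictSubtree {V A : Type} [DecidableEq V] [One A] {O : OpSet A}
    (c c' : Store V A × Stmt V O) : Prop :=
  Relation.TransGen Child c' c

/-- Aperiodic programs. -/
def AP (V : Type) {A : Type} [DecidableEq V] [One A] (O : OpSet A) : Set (Program V O) :=
  {P | ∀ μ : Store V A, ¬ ∃ (e : Expr V O) (s : Stmt V O) (μ' μ'' : Store V A),
    Subtree (μ', Stmt.while e s) (μ, P.body) ∧
    Subtree (μ'', Stmt.while e s) (μ, P.body) ∧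
    StrictSubtree (μ'', Stmt.while e s) (μ', Stmt.while e s) ∧
    e.StoreEquiv μ' μ''}

end Declass

/-!
Fix a safe typing of a program and bound the lengths of the values stored in a variable by an
antitone function `m` of the level of the variable. Inside a loop, only neutral and positive
operators are admissible, and an expression whose level is at least the innermost level `i` is built
by neutral operators from variables and declassifications, so it is no longer than what is stored at
its own level. An expression of lower level is longer by at most a constant
(`Expr.HasLevel.eval_length`). Hence a loop of level `i` leaves `m` unchanged at all levels `≥ i`,
and the variables that occur undeclassified in its guard have such levels. Their values can thus be
coded in a finite set whose size depends on `m i` only, and aperiodicity says that no code occurs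
twice: the number of iterations is bounded (`exec_iterations`). This gives termination.

The same count bounds the growth. Executing a statement increases the bound `m ℓ` at a level `ℓ < i`
by at most a function of `m (ℓ + 1)` (`Grows`, `Stmt.HasLevel.exists_grows`). As this increment does
not depend on `m ℓ` itself, the form of the bound survives the iteration of a loop, by descending
induction on the level (`iterate_grow_le`), and all functions that arise are dominated by a tower of
exponentials of constant height. So a safe aperiodic program has outputs of length at most
`tower k n` on inputs of length at most `n`, with a fixed `k`. Three nested loops with `+1` and `-1`
compute `1ⁿ ↦ 1^(tower n 0)`, which exceeds every such bound; this function witnesses strictness.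
-/

namespace Declass

/-! ### Towers of exponentials -/

/-- The tower of `k` exponentials of base `2` with `n` on top. -/
def tower (k n : ℕ) : ℕ := (fun x => 2 ^ x)^[k] n

/-- Dominated by a tower of exponentials of constant height. -/
def TowerBounded (f : ℕ → ℕ) : Prop := ∃ k, ∀ n, f n ≤ tower k n

theorem tower_succ (k n : ℕ) : tower (k + 1) n = 2 ^ tower k n :=
  Function.iterate_succ_apply' _ _ _

theorem tower_add (a b n : ℕ) : tower (a + b) n = tower a (tower b n) :=
  Function.iterate_add_apply _ _ _ _

theorem tower_strictMono (k : ℕ) : StrictMono (tower k) :=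
  StrictMono.iterate (fun _ _ h => Nat.pow_lt_pow_right one_lt_two h) k

theorem add_le_tower (k n : ℕ) : n + k ≤ tower k n := by
  induction k with
  | zero => rfl
  | succ k ih =>
    rw [tower_succ]
    have := Nat.lt_two_pow_self (n := tower k n)
    omega

theorem tower_le_tower {k k' : ℕ} (h : k ≤ k') (n : ℕ) : tower k n ≤ tower k' n := by
  obtain ⟨d, rfl⟩ := Nat.exists_eq_add_of_le h
  rw [tower_add]
  exact (tower_strictMono k).monotone ((Nat.le_add_right _ _).trans (add_le_tower d n))

theorem two_mul_le_two_pow (x : ℕ) : 2 * x ≤ 2 ^ x := by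
  cases x with
  | zero => simp
  | succ x =>
    have := Nat.lt_two_pow_self (n := x)
    rw [pow_succ]
    omega

namespace TowerBounded

theorem of_le {f g : ℕ → ℕ} (hg : TowerBounded g) (h : ∀ n, f n ≤ g n) : TowerBounded f := by
  obtain ⟨k, hk⟩ := hg
  exact ⟨k, fun n => (h n).trans (hk n)⟩

theorem tower (k : ℕ) : TowerBounded (tower k) := ⟨k, fun _ => le_rfl⟩

theorem id : TowerBounded fun n => n := ⟨0, fun _ => le_rfl⟩

theorem const (c : ℕ) : TowerBounded fun _ => c :=
  ⟨c, fun n => (Nat.le_add_left c n).trans (add_le_tower c n)⟩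

theorem comp {f g : ℕ → ℕ} (hf : TowerBounded f) (hg : TowerBounded g) :
    TowerBounded fun n => f (g n) := by
  obtain ⟨a, ha⟩ := hf
  obtain ⟨b, hb⟩ := hg
  refine ⟨a + b, fun n => (ha _).trans ?_⟩
  rw [tower_add]
  exact (tower_strictMono a).monotone (hb n)

theorem sup {f g : ℕ → ℕ} (hf : TowerBounded f) (hg : TowerBounded g) :
    TowerBounded fun n => max (f n) (g n) := by
  obtain ⟨a, ha⟩ := hf
  obtain ⟨b, hb⟩ := hg
  exact ⟨max a b, fun n => max_le ((ha n).trans (tower_le_tower (le_max_left _ _) n))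
    ((hb n).trans (tower_le_tower (le_max_right _ _) n))⟩

theorem add {f g : ℕ → ℕ} (hf : TowerBounded f) (hg : TowerBounded g) :
    TowerBounded fun n => f n + g n := by
  refine ((tower 1).comp (hf.sup hg)).of_le fun n => ?_
  refine le_trans ?_ (two_mul_le_two_pow (max (f n) (g n)))
  have h₁ := le_max_left (f n) (g n)
  have h₂ := le_max_right (f n) (g n)
  omega

theorem mul {f g : ℕ → ℕ} (hf : TowerBounded f) (hg : TowerBounded g) :
    TowerBounded fun n => f n * g n := by
  refine ((tower 1).comp (hf.add hg)).of_le fun n => ?_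
  change f n * g n ≤ 2 ^ (f n + g n)
  rw [pow_add]
  exact Nat.mul_le_mul Nat.lt_two_pow_self.le Nat.lt_two_pow_self.le

theorem pow {f g : ℕ → ℕ} (hf : TowerBounded f) (hg : TowerBounded g) :
    TowerBounded fun n => f n ^ g n := by
  refine ((tower 1).comp (hf.mul hg)).of_le fun n => ?_
  change f n ^ g n ≤ 2 ^ (f n * g n)
  rw [pow_mul]
  exact Nat.pow_le_pow_left Nat.lt_two_pow_self.le _

theorem polynomial (p : Polynomial ℕ) : TowerBounded fun n => p.eval n := by
  induction p using Polynomial.induction_on' with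
  | add p q hp hq => simpa only [Polynomial.eval_add] using hp.add hq
  | monomial d a =>
    simpa only [Polynomial.eval_monomial] using (const a).mul (id.pow (const d))

end TowerBounded

theorem exists_tower_lt_tower_zero (k : ℕ) : ∃ n, tower k n < tower n 0 := by
  refine ⟨k + (k + 5), ?_⟩
  rw [tower_add]
  refine tower_strictMono k ?_
  rw [tower_succ]
  have h₁ : 2 ^ (k + 4) ≤ 2 ^ tower (k + 4) 0 :=
    Nat.pow_le_pow_right two_pos ((Nat.le_add_left _ _).trans (add_le_tower _ _))
  have h₂ := Nat.lt_two_pow_self (n := k)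
  rw [pow_add] at h₁
  omega

/-! ### Classes of operators -/

section Operators

variable {A : Type} {k : ℕ} {f : (Fin k → Word A) → Word A}

theorem length_le_maxLen (w : Fin k → Word A) (n : Fin k) : (w n).length ≤ maxLen w :=
  Finset.le_sup (f := fun n => (w n).length) (Finset.mem_univ n)

theorem maxLen_le {w : Fin k → Word A} {c : ℕ} (h : ∀ n, (w n).length ≤ c) : maxLen w ≤ c :=
  Finset.sup_le fun n _ => h n

theorem IsNeutral.isPositive [Zero A] [One A] (h : IsNeutral f) : IsPositive f := by
  refine ⟨1, fun w => ?_⟩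
  rcases h with h | ⟨n, h⟩
  · rcases h w with h | h <;> simp [h]
  · exact ((h w).length_le.trans (length_le_maxLen w n)).trans (Nat.le_add_right _ _)

theorem IsPositive.isPolynomial (h : IsPositive f) : IsPolynomial f := by
  obtain ⟨c, h⟩ := h
  exact ⟨Polynomial.X + Polynomial.C c, by simpa using h⟩

end Operators

/-! ### Growth of values inside loops -/

section Growth

variable {V A : Type} {O : OpSet A} {Γ : VarEnv V} {Δ : OpEnv O}

/-- The level of a variable; variables without a level, which a typed statement can neither read
nor assign, get level `0`. -/
def VarEnv.lev (Γ : VarEnv V) (x : V) : ℕ := (Γ.level x).getD 0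

theorem VarEnv.lev_eq {x : V} {τ : ℕ} (h : Γ.level x = some τ) : Γ.lev x = τ := by
  simp [VarEnv.lev, h]

/-- Every variable of level `ℓ` stores a word of length at most `m ℓ`. -/
def Bounded (Γ : VarEnv V) (m : ℕ → ℕ) (μ : Store V A) : Prop :=
  ∀ x, (μ x).length ≤ m (Γ.lev x)

/-- Admissible length bounds: larger at lower levels, and never below the length of a truth
value. -/
structure IsBound (m : ℕ → ℕ) : Prop where
  anti : Antitone m
  one_le : ∀ ℓ, 1 ≤ m ℓ

/-- The length bounds after a statement executed at innermost level `i` from a store with length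
bounds `m`. The increment at level `ℓ` depends on the bound at level `ℓ + 1` only. -/
def grow (k i : ℕ) (m : ℕ → ℕ) (ℓ : ℕ) : ℕ :=
  if i ≤ ℓ then m ℓ else m ℓ + tower k (m (ℓ + 1))

theorem grow_of_le {k i ℓ : ℕ} (m : ℕ → ℕ) (h : i ≤ ℓ) : grow k i m ℓ = m ℓ := if_pos h

theorem grow_of_lt {k i ℓ : ℕ} (m : ℕ → ℕ) (h : ℓ < i) :
    grow k i m ℓ = m ℓ + tower k (m (ℓ + 1)) := if_neg h.not_ge

theorem le_grow (k i : ℕ) (m : ℕ → ℕ) (ℓ : ℕ) : m ℓ ≤ grow k i m ℓ := by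
  unfold grow
  split_ifs
  · exact le_rfl
  · exact Nat.le_add_right _ _

theorem grow_le_add (k i : ℕ) (m : ℕ → ℕ) (ℓ : ℕ) :
    grow k i m ℓ ≤ m ℓ + tower k (m (ℓ + 1)) := by
  unfold grow
  split_ifs
  · exact Nat.le_add_right _ _
  · exact le_rfl

theorem grow_mono {k k' i i' : ℕ} (hk : k ≤ k') (hi : i ≤ i') (m : ℕ → ℕ) (ℓ : ℕ) :
    grow k i m ℓ ≤ grow k' i' m ℓ := by
  rcases lt_or_ge ℓ i with h | h
  · rw [grow_of_lt m h, grow_of_lt m (h.trans_le hi)]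
    exact Nat.add_le_add_left (tower_le_tower hk _) _
  · rw [grow_of_le m h]
    exact le_grow _ _ _ _

theorem IsBound.grow {m : ℕ → ℕ} (hm : IsBound m) (k i : ℕ) : IsBound (grow k i m) := by
  refine ⟨antitone_nat_of_succ_le fun ℓ => ?_, fun ℓ => (hm.one_le ℓ).trans (le_grow _ _ _ _)⟩
  rcases lt_or_ge ℓ i with h | h
  · rw [grow_of_lt m h]
    exact (grow_le_add _ _ _ _).trans (Nat.add_le_add (hm.anti (Nat.le_succ _))
      ((tower_strictMono k).monotone (hm.anti (Nat.le_succ _))))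
  · rw [grow_of_le m h, grow_of_le m (h.trans (Nat.le_succ _))]
    exact hm.anti (Nat.le_succ _)

theorem Bounded.mono {m m' : ℕ → ℕ} {μ : Store V A} (h : Bounded Γ m μ) (hm : ∀ ℓ, m ℓ ≤ m' ℓ) :
    Bounded Γ m' μ := fun x => (h x).trans (hm _)

theorem exists_grow_grow_le (k₁ k₂ i : ℕ) : ∃ k, ∀ m, IsBound m → ∀ ℓ,
    grow k₂ i (grow k₁ i m) ℓ ≤ grow k i m ℓ := by
  obtain ⟨k, hk⟩ := (TowerBounded.tower k₁).add
    ((TowerBounded.tower k₂).comp (TowerBounded.id.add (TowerBounded.tower k₁)))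
  refine ⟨k, fun m hm ℓ => ?_⟩
  rcases lt_or_ge ℓ i with h | h
  · rw [grow_of_lt _ h, grow_of_lt _ h, grow_of_lt _ h, add_assoc]
    refine Nat.add_le_add_left (le_trans ?_ (hk (m (ℓ + 1)))) _
    refine Nat.add_le_add_left ((tower_strictMono k₂).monotone ?_) _
    exact (grow_le_add _ _ _ _).trans (Nat.add_le_add_left
      ((tower_strictMono k₁).monotone (hm.anti (Nat.le_succ _))) _)
  · simp only [grow_of_le _ h, le_refl]

theorem iterate_grow_of_le {k i ℓ : ℕ} (m : ℕ → ℕ) (h : i ≤ ℓ) (t : ℕ) :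
    (grow k i)^[t] m ℓ = m ℓ := by
  induction t with
  | zero => rfl
  | succ t ih => rw [Function.iterate_succ_apply', grow_of_le _ h, ih]

/-- If the number of iterations is bounded in terms of the level `i`, then iterating `grow k i` is
dominated by a single `grow k' i`. By descending induction on the level: once the bound at level
`ℓ + 1` is known to stay small during all iterations, the bound at level `ℓ` grows linearly. -/
theorem iterate_grow_le (k c i : ℕ) : ∃ k', ∀ m, IsBound m → ∀ t ≤ tower c (m i), ∀ ℓ,
    (grow k i)^[t] m ℓ ≤ grow k' i m ℓ := by
  suffices H : ∀ d, ∃ k', ∀ m, IsBound m → ∀ t ≤ tower c (m i), ∀ ℓ, i ≤ ℓ + d →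
      (grow k i)^[t] m ℓ ≤ grow k' i m ℓ by
    obtain ⟨k', h⟩ := H i
    exact ⟨k', fun m hm t ht ℓ => h m hm t ht ℓ (Nat.le_add_left _ _)⟩
  intro d
  induction d with
  | zero =>
    refine ⟨0, fun m hm t _ ℓ h => ?_⟩
    rw [iterate_grow_of_le (ℓ := ℓ) m h]
    exact le_grow _ _ _ _
  | succ d ih =>
    obtain ⟨k₁, h₁⟩ := ih
    obtain ⟨k', hk'⟩ := (TowerBounded.tower c).mul
      ((TowerBounded.tower k).comp (TowerBounded.id.add (TowerBounded.tower k₁)))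
    refine ⟨k', fun m hm t ht ℓ hℓ => ?_⟩
    -- Throughout, the bound at level `ℓ + 1` is at most `m (ℓ + 1) + tower k₁ (m (ℓ + 1))`.
    rcases lt_or_ge ℓ i with h | h
    · have key : ∀ s ≤ t, (grow k i)^[s] m ℓ ≤
          m ℓ + s * tower k (m (ℓ + 1) + tower k₁ (m (ℓ + 1))) := by
        intro s
        induction s with
        | zero => intro _; simp
        | succ s ihs =>
          intro hs
          rw [Function.iterate_succ_apply', grow_of_lt _ h, Nat.succ_mul, ← add_assoc]
          refine Nat.add_le_add (ihs (by omega)) ((tower_strictMono k).monotone ?_)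
          exact (h₁ m hm s (by omega) (ℓ + 1) (by omega)).trans ((grow_le_add _ _ _ _).trans
            (Nat.add_le_add_left ((tower_strictMono k₁).monotone (hm.anti (Nat.le_succ _))) _))
      rw [grow_of_lt m h]
      refine (key t le_rfl).trans (Nat.add_le_add_left (le_trans ?_ (hk' (m (ℓ + 1)))) _)
      exact Nat.mul_le_mul_right _ (ht.trans ((tower_strictMono c).monotone (hm.anti h)))
    · rw [iterate_grow_of_le m h]
      exact le_grow _ _ _ _

/-- Inside loops a typed expression is longer than what is stored at its level by at most a
constant, and not longer at all if its level is at least the innermost level. -/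
theorem Expr.HasLevel.eval_length [Zero A] [One A] (hΔ : Δ.IsSafe) {i j τ : ℕ} {e : Expr V O}
    (h : e.HasLevel Γ Δ i j τ) (hi : 1 ≤ i) (hij : i ≤ j) :
    ∃ c, ∀ m, IsBound m → ∀ μ : Store V A, Bounded Γ m μ →
      (e.eval μ).length ≤ m τ + c ∧ (i ≤ τ → (e.eval μ).length ≤ m τ) := by
  induction h with
  | @var x τ hx =>
    refine ⟨0, fun m hm μ hμ => ?_⟩
    have := hμ x
    rw [VarEnv.lev_eq hx] at this
    exact ⟨this, fun _ => this⟩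
  | @op o args τs τ hadm _ ih =>
    choose c hc using ih
    obtain ⟨hcls, -, hsafe⟩ := hΔ o ⟨i, j, _, hadm⟩
    obtain ⟨hneu, hpos, hpol⟩ := hsafe i j τs τ hadm
    by_cases hN : IsNeutral (O.sem o)
    · refine ⟨Finset.univ.sup c, fun m hm μ hμ => ?_⟩
      change (O.sem o fun n => (args n).eval μ).length ≤ _ ∧
        (_ → (O.sem o fun n => (args n).eval μ).length ≤ _)
      have h1 := hm.one_le τ
      rcases id hN with hb | ⟨n, hn⟩
      · have : (O.sem o fun n => (args n).eval μ).length = 1 := by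
          rcases hb fun n => (args n).eval μ with h | h <;> simp [h]
        omega
      · have h2 := (hn fun n => (args n).eval μ).length_le
        have h3 := hm.anti (hneu hN n)
        have h4 := hc n m hm μ hμ
        have h5 : c n ≤ Finset.univ.sup c := Finset.le_sup (Finset.mem_univ n)
        exact ⟨by omega, fun hτ => h2.trans ((h4.2 (hτ.trans (hneu hN n))).trans h3)⟩
    · have hP : IsPositive (O.sem o) := by
        by_contra hP
        rcases hcls with h | h | h
        · exact hN h
        · exact hP h
        · have := hpol h hP
          omega
      obtain ⟨hle, hlt⟩ := hpos hP hN
      obtain ⟨d, hd⟩ := hP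
      refine ⟨Finset.univ.sup c + d, fun m hm μ hμ => ⟨?_, fun hτ => by omega⟩⟩
      refine (hd _).trans ?_
      rw [← add_assoc]
      refine Nat.add_le_add_right (maxLen_le fun n => ?_) _
      exact (hc n m hm μ hμ).1.trans (Nat.add_le_add (hm.anti (hle n))
        (Finset.le_sup (Finset.mem_univ n)))
  | @declass e₁ e₂ τ₁ τ _ _ _ hτj _ ih₂ =>
    obtain ⟨c, hc⟩ := ih₂
    refine ⟨0, fun m hm μ hμ => ?_⟩
    have : ((Expr.declass e₁ e₂).eval μ).length ≤ m τ := by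
      simp only [Expr.eval, List.length_replicate]
      exact (min_le_right _ _).trans (((hc m hm μ hμ).2 hij).trans (hm.anti hτj))
    exact ⟨this, fun _ => this⟩

/-- Inside loops, undeclassified variables of an expression whose level is at least the innermost
level have such levels themselves. -/
theorem Expr.HasLevel.le_lev [Zero A] [One A] (hΔ : Δ.IsSafe) {i j τ : ℕ} {e : Expr V O}
    (h : e.HasLevel Γ Δ i j τ) (hi : 1 ≤ i) (hij : i ≤ j) (hτ : i ≤ τ) :
    ∀ x ∈ e.undeclassified, i ≤ Γ.lev x := by
  induction h with
  | @var x τ hx =>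
    rintro y rfl
    rwa [VarEnv.lev_eq hx]
  | @op o args τs τ hadm _ ih =>
    obtain ⟨hcls, -, hsafe⟩ := hΔ o ⟨i, j, _, hadm⟩
    obtain ⟨hneu, hpos, hpol⟩ := hsafe i j τs τ hadm
    intro x hx
    obtain ⟨n, hn⟩ := Set.mem_iUnion.1 hx
    refine ih n (hτ.trans ?_) x hn
    by_cases hN : IsNeutral (O.sem o)
    · exact hneu hN n
    · by_cases hP : IsPositive (O.sem o)
      · exact (hpos hP hN).1 n
      · have := hpol (hcls.resolve_left hN |>.resolve_left hP) hP
        omega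
  | declass _ _ _ _ _ ih₂ => exact ih₂ hij

theorem Expr.finite_undeclassified (e : Expr V O) : e.undeclassified.Finite := by
  induction e with
  | var x => exact Set.finite_singleton x
  | op o args ih => exact Set.finite_iUnion ih
  | declass e₁ e₂ _ ih => exact ih

/-! ### Iterations of aperiodic loops -/

/-- No two nested evaluations of the same loop, below the configuration `c`, start from stores that
are equivalent for its guard. -/
def Aperiodic [DecidableEq V] [One A] (c : Store V A × Stmt V O) : Prop :=
  ∀ (e : Expr V O) (s : Stmt V O) (μ μ' : Store V A), Subtree (μ, .while e s) c →
    StrictSubtree (μ', .while e s) (μ, .while e s) → ¬ e.StoreEquiv μ μ'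

theorem Aperiodic.of_subtree [DecidableEq V] [One A] {c c' : Store V A × Stmt V O} (h : Aperiodic c)
    (hc : Subtree c' c) : Aperiodic c' :=
  fun e s μ μ' h₁ h₂ => h e s μ μ' (hc.trans h₁) h₂

theorem Aperiodic.child [DecidableEq V] [One A] {c c' : Store V A × Stmt V O} (h : Aperiodic c)
    (hc : Child c c') : Aperiodic c' :=
  h.of_subtree (.single hc)

/-- At innermost level `i`, all aperiodic executions of `s` end, and turn length bounds `m` into
`grow k i m`. -/
def Grows [DecidableEq V] [One A] (Γ : VarEnv V) (i k : ℕ) (s : Stmt V O) : Prop :=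
  ∀ m, IsBound m → ∀ μ : Store V A, Aperiodic (μ, s) → Bounded Γ m μ →
    ∃ b μ', Exec μ s b μ' ∧ Bounded Γ (grow k i m) μ'

theorem Grows.mono [DecidableEq V] [One A] {i i' k k' : ℕ} {s : Stmt V O} (h : Grows Γ i k s)
    (hi : i ≤ i') (hk : k ≤ k') : Grows Γ i' k' s := by
  intro m hm μ hμ hb
  obtain ⟨b, μ', h₁, h₂⟩ := h m hm μ hμ hb
  exact ⟨b, μ', h₁, h₂.mono (grow_mono hk hi m)⟩

/-- The first `y` letters of the values of the variables in `X`, padded with `none`. -/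
def storeCode (X : Set V) (y : ℕ) (μ : Store V A) : X → Fin y → Option A :=
  fun x n => (μ x)[(n : ℕ)]?

theorem eq_of_storeCode_eq {X : Set V} {y : ℕ} {μ μ' : Store V A}
    (h : storeCode X y μ = storeCode X y μ') (hμ : ∀ x ∈ X, (μ x).length ≤ y)
    (hμ' : ∀ x ∈ X, (μ' x).length ≤ y) : ∀ x ∈ X, μ x = μ' x := by
  intro x hx
  refine List.ext_getElem? fun n => ?_
  rcases lt_or_ge n y with hn | hn
  · exact congrFun (congrFun h ⟨x, hx⟩) ⟨n, hn⟩
  · rw [List.getElem?_eq_none ((hμ x hx).trans hn), List.getElem?_eq_none ((hμ' x hx).trans hn)]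

theorem StrictSubtree.while_of_exec [DecidableEq V] [One A] {e : Expr V O} {s : Stmt V O}
    {μ μ' : Store V A} (he : e.eval μ = [1]) (h : Exec μ s .top μ') :
    StrictSubtree (μ', Stmt.while e s) (μ, Stmt.while e s) :=
  Relation.TransGen.tail (.single (.while he)) (.seqRight h)

/-- An aperiodic loop of level `i` makes at most `n` iterations, if all but `n` of the codes of its
guard variables have been seen already, in the stores from which a loop evaluation above the
present one started. -/
theorem exec_iterations [DecidableEq V] [One A] {i k y : ℕ} {e : Expr V O} {s : Stmt V O}
    [Fintype (e.undeclassified → Fin y → Option A)]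
    (hU : ∀ x ∈ e.undeclassified, i ≤ Γ.lev x) (hs : Grows Γ i k s) {μ₀ : Store V A}
    (h₀ : Aperiodic (μ₀, .while e s)) (n : ℕ) :
    ∀ (seen : Finset (e.undeclassified → Fin y → Option A)) (m : ℕ → ℕ) (μ : Store V A),
      IsBound m → m i = y → Bounded Γ m μ → Subtree (μ, .while e s) (μ₀, .while e s) →
      (∀ v ∈ seen, ∃ ν, storeCode e.undeclassified y ν = v ∧
        (∀ x ∈ e.undeclassified, (ν x).length ≤ y) ∧
        Subtree (ν, .while e s) (μ₀, .while e s) ∧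
        StrictSubtree (μ, .while e s) (ν, .while e s)) →
      Fintype.card (e.undeclassified → Fin y → Option A) ≤ seen.card + n →
      ∃ t ≤ n, ∃ μ', Exec μ (.while e s) .top μ' ∧ Bounded Γ ((grow k i)^[t] m) μ' := by
  classical
  induction n with
  | zero =>
    intro seen m μ hm hy hb hsub hseen hcard
    exfalso
    have huniv := (Finset.card_eq_iff_eq_univ seen).1
      (le_antisymm (Finset.card_le_univ _) (by simpa using hcard))
    obtain ⟨ν, h₁, h₂, h₃, h₄⟩ := hseen (storeCode e.undeclassified y μ)
      (huniv ▸ Finset.mem_univ _)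
    exact h₀ e s ν μ h₃ h₄ (eq_of_storeCode_eq h₁ h₂
      fun x hx => (hb x).trans (hy ▸ hm.anti (hU x hx)))
  | succ n ih =>
    intro seen m μ hm hy hb hsub hseen hcard
    have hlen : ∀ x ∈ e.undeclassified, (μ x).length ≤ y :=
      fun x hx => (hb x).trans (hy ▸ hm.anti (hU x hx))
    by_cases he : e.eval μ = [1]
    · have hap : Aperiodic (μ, s) := (h₀.of_subtree hsub).of_subtree
        (Relation.ReflTransGen.tail (.single (.while he)) .seqLeft)
      obtain ⟨b, μ₁, hex, hb₁⟩ := hs m hm μ hap hb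
      cases b with
      | bot => exact ⟨1, by omega, μ₁, .whileTrue he (.seqBreak hex), hb₁⟩
      | top =>
        have hstep := StrictSubtree.while_of_exec he hex
        have hnew : storeCode e.undeclassified y μ ∉ seen := by
          intro hmem
          obtain ⟨ν, h₁, h₂, h₃, h₄⟩ := hseen _ hmem
          exact h₀ e s ν μ h₃ h₄ (eq_of_storeCode_eq h₁ h₂ hlen)
        obtain ⟨t, ht, μ₂, hex₂, hb₂⟩ := ih (insert (storeCode e.undeclassified y μ) seen)
          (grow k i m) μ₁ (hm.grow k i) (by rw [grow_of_le m le_rfl, hy]) hb₁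
          (hsub.trans hstep.to_reflTransGen)
          (by
            intro v hv
            rcases Finset.mem_insert.1 hv with rfl | hv
            · exact ⟨μ, rfl, hlen, hsub, hstep⟩
            · obtain ⟨ν, h₁, h₂, h₃, h₄⟩ := hseen v hv
              exact ⟨ν, h₁, h₂, h₃, Relation.TransGen.trans h₄ hstep⟩)
          (by rw [Finset.card_insert_of_notMem hnew]; omega)
        exact ⟨t + 1, by omega, μ₂, .whileTrue he (.seq hex hex₂), hb₂⟩
    · exact ⟨0, by omega, μ, .whileFalse he, hb⟩

theorem Grows.exists_while [DecidableEq V] [Finite A] [One A] {i k : ℕ} {e : Expr V O}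
    {s : Stmt V O} (hU : ∀ x ∈ e.undeclassified, i ≤ Γ.lev x) (hs : Grows Γ i k s) :
    ∃ k', Grows Γ i k' (.while e s) := by
  classical
  have := Fintype.ofFinite A
  have := e.finite_undeclassified.fintype
  obtain ⟨c, hc⟩ : TowerBounded fun y => Fintype.card (e.undeclassified → Fin y → Option A) := by
    simp only [Fintype.card_fun, Fintype.card_fin]
    exact ((TowerBounded.const _).pow TowerBounded.id).pow (TowerBounded.const _)
  obtain ⟨k', hk'⟩ := iterate_grow_le k c i
  refine ⟨k', fun m hm μ hμ hb => ?_⟩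
  obtain ⟨t, ht, μ', hex, hb'⟩ := exec_iterations (y := m i) hU hs hμ _ ∅ m μ hm rfl hb .refl
    (by simp) (by rw [Finset.card_empty, Nat.zero_add])
  exact ⟨.top, μ', hex, hb'.mono (hk' m hm t (ht.trans (hc _)))⟩

/-- Statements inside loops. The hypothesis `τ ≤ i` holds for the body of a loop and is inherited
by its parts; it ensures that inner loops have levels at most `i`. -/
theorem Stmt.HasLevel.exists_grows [DecidableEq V] [Finite A] [Zero A] [One A] (hΔ : Δ.IsSafe)
    {i j τ : ℕ} {s : Stmt V O}
    (h : s.HasLevel Γ Δ i j τ) (hi : 1 ≤ i) (hij : i ≤ j) (hτ : τ ≤ i) :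
    ∃ k, Grows Γ i k s := by
  induction h with
  | sub _ hle ih => exact ih hi hij (hle.trans hτ)
  | skip => exact ⟨0, fun m hm μ _ hb => ⟨.top, μ, .skip μ, hb.mono (le_grow _ _ _)⟩⟩
  | @assign i j τ₁ τ₂ x e hx he hle =>
    obtain ⟨c, hc⟩ := he.eval_length hΔ hi hij
    refine ⟨c, fun m hm μ _ hb => ⟨.top, _, .assign μ x e, fun z => ?_⟩⟩
    rcases eq_or_ne z x with rfl | hz
    · rw [Function.update_self, VarEnv.lev_eq hx]
      have hle : τ₁ ≤ τ₂ := hle.resolve_left (by omega)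
      obtain ⟨h₁, h₂⟩ := hc m hm μ hb
      rcases lt_or_ge τ₁ i with h | h
      · rw [grow_of_lt m h]
        exact h₁.trans (Nat.add_le_add (hm.anti hle)
          ((Nat.le_add_left _ _).trans (add_le_tower _ _)))
      · rw [grow_of_le m h]
        exact (h₂ (h.trans hle)).trans (hm.anti hle)
    · rw [Function.update_of_ne hz]
      exact (hb z).trans (le_grow _ _ _ _)
  | @seq i j τ s₁ s₂ _ _ ih₁ ih₂ =>
    obtain ⟨k₁, h₁⟩ := ih₁ hi hij hτ
    obtain ⟨k₂, h₂⟩ := ih₂ hi hij hτ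
    obtain ⟨k, hk⟩ := exists_grow_grow_le k₁ k₂ i
    refine ⟨k, fun m hm μ hμ hb => ?_⟩
    obtain ⟨b, μ₁, hex₁, hb₁⟩ := h₁ m hm μ (hμ.child .seqLeft) hb
    cases b with
    | bot =>
      exact ⟨.bot, μ₁, .seqBreak hex₁,
        hb₁.mono fun ℓ => (le_grow k₂ i (grow k₁ i m) ℓ).trans (hk m hm ℓ)⟩
    | top =>
      obtain ⟨b, μ₂, hex₂, hb₂⟩ := h₂ _ (hm.grow k₁ i) μ₁ (hμ.child (.seqRight hex₁)) hb₁
      exact ⟨b, μ₂, .seq hex₁ hex₂, hb₂.mono (hk m hm)⟩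
  | @ite i j τ e s₁ s₀ _ _ _ ih₁ ih₀ =>
    obtain ⟨k₁, h₁⟩ := ih₁ hi hij hτ
    obtain ⟨k₀, h₀⟩ := ih₀ hi hij hτ
    refine ⟨max k₁ k₀, fun m hm μ hμ hb => ?_⟩
    by_cases he : e.eval μ = [1]
    · obtain ⟨b, μ', hex, hb'⟩ :=
        h₁.mono le_rfl (le_max_left k₁ k₀) m hm μ (hμ.child (.iteTrue he)) hb
      exact ⟨b, μ', .iteTrue he hex, hb'⟩
    · obtain ⟨b, μ', hex, hb'⟩ :=
        h₀.mono le_rfl (le_max_right k₁ k₀) m hm μ (hμ.child (.iteFalse he)) hb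
      exact ⟨b, μ', .iteFalse he hex, hb'⟩
  | @whileInner i j τ e s he _ h1 hj ih =>
    obtain ⟨k, hk⟩ := ih h1 hj le_rfl
    obtain ⟨k', hk'⟩ := hk.exists_while (he.le_lev hΔ h1 hj le_rfl)
    exact ⟨k', hk'.mono hτ le_rfl⟩
  | whileOuter => omega
  | _ =>
    -- the remaining statement is a `break`
    rename_i e _ _
    refine ⟨0, fun m hm μ _ hb => ?_⟩
    by_cases he : e.eval μ = [1]
    · exact ⟨.bot, μ, .breakTrue he, hb.mono (le_grow _ _ _)⟩
    · exact ⟨.top, μ, .breakFalse he, hb.mono (le_grow _ _ _)⟩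

/-! ### Growth of values outside of loops -/

theorem Expr.HasLevel.exists_eval_length_le_tower [Zero A] [One A] (hΔ : Δ.IsSafe) {i j τ : ℕ}
    {e : Expr V O}
    (h : e.HasLevel Γ Δ i j τ) :
    ∃ k, ∀ (n : ℕ) (μ : Store V A), (∀ x, (μ x).length ≤ n) →
      (e.eval μ).length ≤ tower k n := by
  induction h with
  | @var x _ _ => exact ⟨0, fun n μ hμ => hμ x⟩
  | @op o args τs τ hadm _ ih =>
    choose k hk using ih
    have hpoly : IsPolynomial (O.sem o) := by
      rcases (hΔ o ⟨i, j, _, hadm⟩).1 with h | h | h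
      · exact h.isPositive.isPolynomial
      · exact h.isPolynomial
      · exact h
    obtain ⟨p, hp⟩ := hpoly
    obtain ⟨c, hc⟩ := TowerBounded.polynomial p
    refine ⟨c + Finset.univ.sup k, fun n μ hμ => (hp _).trans ((hc _).trans ?_)⟩
    rw [tower_add]
    refine (tower_strictMono c).monotone (maxLen_le fun l => ?_)
    exact (hk l n μ hμ).trans (tower_le_tower (Finset.le_sup (Finset.mem_univ l)) n)
  | declass _ _ _ _ _ ih₂ =>
    obtain ⟨k, hk⟩ := ih₂
    refine ⟨k, fun n μ hμ => ?_⟩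
    simp only [Expr.eval, List.length_replicate]
    exact (min_le_right _ _).trans (hk n μ hμ)

/-- Statements outside of loops. Data may flow there from lower to higher levels, so a single bound
`n` for all variables is used; an outermost loop starts from a constant length bound. -/
theorem Stmt.HasLevel.exists_exec_length_le_tower [DecidableEq V] [Finite A] [Zero A] [One A]
    (hΔ : Δ.IsSafe) {i j τ : ℕ} {s : Stmt V O} (h : s.HasLevel Γ Δ i j τ) (hj : j = 0) :
    ∃ k, ∀ (n : ℕ) (μ : Store V A), Aperiodic (μ, s) → (∀ x, (μ x).length ≤ n) →
      ∃ b μ', Exec μ s b μ' ∧ ∀ x, (μ' x).length ≤ tower k n := by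
  induction h with
  | sub _ _ ih => exact ih hj
  | skip => exact ⟨0, fun n μ _ hb => ⟨.top, μ, .skip μ, hb⟩⟩
  | @assign i j τ₁ τ₂ x e _ he _ =>
    obtain ⟨k, hk⟩ := he.exists_eval_length_le_tower hΔ
    refine ⟨k, fun n μ _ hb => ⟨.top, _, .assign μ x e, fun z => ?_⟩⟩
    rcases eq_or_ne z x with rfl | hz
    · rw [Function.update_self]
      exact hk n μ hb
    · rw [Function.update_of_ne hz]
      exact (hb z).trans ((Nat.le_add_right _ _).trans (add_le_tower k n))
  | @seq i j τ s₁ s₂ _ _ ih₁ ih₂ =>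
    obtain ⟨k₁, h₁⟩ := ih₁ hj
    obtain ⟨k₂, h₂⟩ := ih₂ hj
    refine ⟨k₂ + k₁, fun n μ hμ hb => ?_⟩
    obtain ⟨b, μ₁, hex₁, hb₁⟩ := h₁ n μ (hμ.child .seqLeft) hb
    cases b with
    | bot =>
      exact ⟨.bot, μ₁, .seqBreak hex₁,
        fun x => (hb₁ x).trans (tower_le_tower (Nat.le_add_left _ _) n)⟩
    | top =>
      obtain ⟨b, μ₂, hex₂, hb₂⟩ := h₂ _ μ₁ (hμ.child (.seqRight hex₁)) hb₁
      exact ⟨b, μ₂, .seq hex₁ hex₂, by simpa only [tower_add] using hb₂⟩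
  | @ite i j τ e s₁ s₀ _ _ _ ih₁ ih₀ =>
    obtain ⟨k₁, h₁⟩ := ih₁ hj
    obtain ⟨k₀, h₀⟩ := ih₀ hj
    refine ⟨max k₁ k₀, fun n μ hμ hb => ?_⟩
    by_cases he : e.eval μ = [1]
    · obtain ⟨b, μ', hex, hb'⟩ := h₁ n μ (hμ.child (.iteTrue he)) hb
      exact ⟨b, μ', .iteTrue he hex,
        fun x => (hb' x).trans (tower_le_tower (le_max_left _ _) n)⟩
    · obtain ⟨b, μ', hex, hb'⟩ := h₀ n μ (hμ.child (.iteFalse he)) hb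
      exact ⟨b, μ', .iteFalse he hex,
        fun x => (hb' x).trans (tower_le_tower (le_max_right _ _) n)⟩
  | whileInner => omega
  | @whileOuter τ e s he hs h1 _ =>
    obtain ⟨k, hk⟩ := hs.exists_grows hΔ h1 le_rfl le_rfl
    obtain ⟨k₁, hk₁⟩ := hk.exists_while (he.le_lev hΔ h1 le_rfl le_rfl)
    have hs : TowerBounded fun n => n + 1 := TowerBounded.id.add (TowerBounded.const 1)
    obtain ⟨k₂, hk₂⟩ := hs.add ((TowerBounded.tower k₁).comp hs)
    refine ⟨k₂, fun n μ hμ hb => ?_⟩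
    -- `n + 1` instead of `n`, as bounds must be positive
    obtain ⟨b, μ', hex, hb'⟩ := hk₁ (fun _ => n + 1)
      ⟨antitone_const, fun _ => Nat.le_add_left 1 n⟩ μ hμ
      fun x => (hb x).trans (Nat.le_succ n)
    exact ⟨b, μ', hex, fun x => (hb' x).trans ((grow_le_add _ _ _ _).trans (hk₂ n))⟩
  | _ =>
    -- the remaining statement is a `break`
    rename_i e _ _
    refine ⟨0, fun n μ _ hb => ?_⟩
    by_cases he : e.eval μ = [1]
    · exact ⟨.bot, μ, .breakTrue he, hb⟩
    · exact ⟨.top, μ, .breakFalse he, hb⟩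

end Growth

/-! ### Safe aperiodic programs -/

section Programs

variable {V A : Type} {O : OpSet A}

theorem Exec.eq_top [DecidableEq V] [One A] {μ μ' : Store V A} {s : Stmt V O} {b : Flag}
    (h : Exec μ s b μ') (hs : s.BreaksInLoops) : b = .top := by
  induction h with
  | seq _ _ _ ih => exact ih hs.2
  | seqBreak _ ih => exact ih hs.1
  | iteTrue _ _ ih => exact ih hs.1
  | iteFalse _ _ ih => exact ih hs.2
  | breakTrue => exact hs.elim
  | _ => rfl

theorem Store.length_updates_le [DecidableEq V] (xs : List V) (w : Fin xs.length → Word A)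
    (μ : Store V A) {n : ℕ} (hw : ∀ l, (w l).length ≤ n) (hμ : ∀ x, (μ x).length ≤ n) (x : V) :
    (Store.updates xs w μ x).length ≤ n := by
  induction xs generalizing μ with
  | nil => exact hμ x
  | cons y xs ih =>
    refine ih _ _ (fun l => hw l.succ) fun z => ?_
    rcases eq_or_ne z y with rfl | hz
    · rw [Function.update_self]
      exact hw 0
    · rw [Function.update_of_ne hz]
      exact hμ z

theorem exists_returns_length_le_tower [DecidableEq V] [Finite A] [Zero A] [One A] {P : Program V O}
    (hP : P ∈ SAFE V O ∩ AP V O) :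
    ∃ k, ∀ w, ∃ v, P.Returns w v ∧ v.length ≤ tower k (maxLen w) := by
  obtain ⟨⟨Δ, hΔ, τ, Γ, hty⟩, hAP⟩ := hP
  obtain ⟨k, hk⟩ := hty.exists_exec_length_le_tower hΔ rfl
  refine ⟨k, fun w => ?_⟩
  obtain ⟨b, μ', hex, hb⟩ := hk (maxLen w) (Store.updates P.params w (Store.empty V A))
    (fun e s μ' μ'' h₁ h₂ h₃ => hAP _ ⟨e, s, μ', μ'', h₁, h₁.trans h₂.to_reflTransGen, h₂, h₃⟩)
    (Store.length_updates_le _ _ _ (length_le_maxLen w) fun _ => Nat.zero_le _)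
  obtain rfl := hex.eq_top P.breaks_in_loops
  exact ⟨μ' P.out, ⟨μ', hex, rfl⟩, hb _⟩

theorem exists_length_le_tower_of_mem_functionsOf [DecidableEq V] [Finite A] [Zero A] [One A]
    {F : Σ k : ℕ, (Fin k → Word A) →. Word A}
    (hF : F ∈ functionsOf (SAFE V O ∩ AP V O)) :
    ∃ k, ∀ w, ∃ v ∈ F.2 w, v.length ≤ tower k (maxLen w) := by
  obtain ⟨P, hP, rfl⟩ := hF
  obtain ⟨k, hk⟩ := exists_returns_length_le_tower hP
  refine ⟨k, fun w => ?_⟩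
  obtain ⟨v, hv, hlen⟩ := hk w
  exact ⟨v, (P.mem_sem_iff w v).2 hv, hlen⟩

/-! ### A terminating program that computes a tower of exponentials -/

theorem OpSet.Has.exists_expr [One A] {k : ℕ} {f : (Fin k → Word A) → Word A} (h : O.Has k f)
    (args : Fin k → Expr V O) :
    ∃ e : Expr V O, ∀ μ, e.eval μ = f fun n => (args n).eval μ := by
  obtain ⟨o, rfl, ho⟩ := h
  exact ⟨.op o args, fun μ => ho fun n => (args n).eval μ⟩

theorem length_unaryPred_lt [One A] {w : Word A} (hw : w ≠ []) :
    (unaryPred w).length < w.length := by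
  have := List.length_pos_iff.2 hw
  unfold unaryPred
  split_ifs
  · rw [List.length_tail]
    omega
  · exact this

theorem isUnary_replicate [One A] (n : ℕ) : IsUnary (List.replicate n (1 : A)) :=
  fun _ h => List.eq_of_mem_replicate h

theorem unaryPred_replicate [One A] (n : ℕ) :
    unaryPred (List.replicate (n + 1) (1 : A)) = List.replicate n 1 := by
  rw [unaryPred, if_pos (isUnary_replicate _)]
  rfl

theorem unarySucc_replicate [One A] (n : ℕ) :
    unarySucc (List.replicate n (1 : A)) = List.replicate (n + 1) 1 := by
  rw [unarySucc, if_pos (isUnary_replicate _)]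
  rfl

/-- The loop `while(x ≠ ε){x := x - 1; s}` always ends, and keeps an invariant `R`, if `s` does so
and does not change `x`. The invariant may depend on the value of `x`. -/
theorem exec_countdown [DecidableEq V] [One A] {x : V} {guard pred : Expr V O} {s : Stmt V O}
    (R : Word A → Store V A → Prop)
    (hguard : ∀ w μ, R w μ → μ x = w → (guard.eval μ = [1] ↔ w ≠ []))
    (hpred : ∀ μ : Store V A, pred.eval μ = unaryPred (μ x))
    (hs : ∀ w μ, w ≠ [] → R w μ → ∃ μ',
      Exec (Function.update μ x (unaryPred w)) s .top μ' ∧ μ' x = unaryPred w ∧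
        R (unaryPred w) μ') (w : Word A) :
    ∀ μ, μ x = w → R w μ →
      ∃ μ', Exec μ (.while guard (.seq (.assign x pred) s)) .top μ' ∧ R [] μ' := by
  induction hn : w.length using Nat.strong_induction_on generalizing w with
  | _ n ih =>
    intro μ hx hR
    subst hn
    by_cases hw : w = []
    · subst hw
      exact ⟨μ, .whileFalse fun h => (hguard _ μ hR hx).1 h rfl, hR⟩
    · obtain ⟨μ₁, hex, hx₁, hR₁⟩ := hs w μ hw hR
      obtain ⟨μ₂, hex₂, hR₂⟩ := ih _ (length_unaryPred_lt hw) _ rfl μ₁ hx₁ hR₁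
      refine ⟨μ₂, .whileTrue ((hguard w μ hR hx).2 hw) (.seq (.seq (.assign μ x pred) ?_) hex₂),
        hR₂⟩
      rwa [hpred, hx]

end Programs

/-- Some terminating program computes a function with `1ⁿ ↦ 1^(tower n 0)`:
`while(x){x := x - 1; z := 1;`
`  while(y){y := y - 1; u := z; while(u){u := u - 1; z := z + 1}}; y := z}`,
where a guard stands for the comparison with a variable that is never assigned. The innermost loop
doubles `z`, and the middle one computes `2 ^ y`. -/
theorem exists_terminating_tower {A : Type} [LinearOrder A] [Zero A] [One A]
    [NeZero (1 : A)] {V : Type} [DecidableEq V] [Infinite V] (O : OpSet A)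
    (hO : O.IncludesBasic) :
    ∃ P ∈ TERM V O, P.params.length = 1 ∧ ∀ w n, (∀ l, w l = List.replicate n 1) → ∀ v,
      P.Returns w v → v.length = tower n 0 := by
  have hg : ∀ a b : V, ∃ g : Expr V O, ∀ μ, g.eval μ = [1] ↔ μ a ≠ μ b := by
    intro a b
    obtain ⟨g, hg⟩ := hO.eq.exists_expr ![Expr.var a, Expr.var b]
    obtain ⟨g', hg'⟩ := hO.not.exists_expr ![g]
    refine ⟨g', fun μ => ?_⟩
    by_cases h : μ a = μ b <;> simp [hg', hg, boolWord, Expr.eval, h]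
  have hp : ∀ a : V, ∃ g : Expr V O, ∀ μ, g.eval μ = unaryPred (μ a) := fun a => by
    obtain ⟨g, hg⟩ := hO.pred.exists_expr ![Expr.var a]
    exact ⟨g, hg⟩
  have hq : ∀ a : V, ∃ g : Expr V O, ∀ μ, g.eval μ = unarySucc (μ a) := fun a => by
    obtain ⟨g, hg⟩ := hO.succ.exists_expr ![Expr.var a]
    exact ⟨g, hg⟩
  choose guard hguard using hg
  choose pred hpred using hp
  choose succ hsucc using hq
  -- `o` is never assigned, hence stays empty
  obtain ⟨x, y, z, u, o, hxy, hxz, hxu, hxo, hyz, hyu, hyo, hzu, hzo, huo⟩ : ∃ x y z u o : V,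
      x ≠ y ∧ x ≠ z ∧ x ≠ u ∧ x ≠ o ∧ y ≠ z ∧ y ≠ u ∧ y ≠ o ∧ z ≠ u ∧ z ≠ o ∧ u ≠ o := by
    let f := Infinite.natEmbedding V
    refine ⟨f 0, f 1, f 2, f 3, f 4, ?_⟩
    simp [f.injective.eq_iff]
  let down (a : V) (s : Stmt V O) : Stmt V O :=
    .while (guard a o) (.seq (.assign a (pred a)) s)
  let double : Stmt V O := .seq (.assign u (.var z)) (down u (.assign z (succ z)))
  let exp : Stmt V O := .seq (.assign z (succ o)) (.seq (down y double) (.assign y (.var z)))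
  have exec_double : ∀ (μ : Store V A) (c : ℕ), μ o = [] → μ z = List.replicate c 1 →
      ∃ μ', Exec μ double .top μ' ∧ μ' o = [] ∧ μ' x = μ x ∧ μ' y = μ y ∧
        μ' z = List.replicate (2 * c) 1 := by
    intro μ c ho hz
    obtain ⟨μ', hex, h₁, h₂, h₃, n, d, hn, hd, hnd⟩ := exec_countdown (x := u) (pred := pred u)
      (guard := guard u o) (s := .assign z (succ z))
      (fun w ν => ν o = [] ∧ ν x = μ x ∧ ν y = μ y ∧ ∃ n d,
        w = List.replicate n 1 ∧ ν z = List.replicate d 1 ∧ n + d = 2 * c)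
      (fun w ν h hw => by rw [hguard, hw, h.1]) (hpred u)
      (by
        rintro w ν hw ⟨h₁, h₂, h₃, n, d, rfl, hd, hnd⟩
        obtain ⟨n, rfl⟩ := Nat.exists_eq_succ_of_ne_zero (n := n) (by rintro rfl; exact hw rfl)
        refine ⟨_, .assign _ _ _, ?_, ?_, ?_, ?_, n, d + 1, ?_, ?_, by omega⟩
        · simp [hzu.symm]
        · simp [hzo.symm, huo.symm, h₁]
        · simp [hxz, hxu, h₂]
        · simp [hyz, hyu, h₃]
        · exact unaryPred_replicate n
        · simp [hsucc, hzu, hd, unarySucc_replicate])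
      _ (Function.update μ u (μ z)) rfl
      ⟨by simp [huo.symm, ho], by simp [hxu], by simp [hyu], c, c, by simp [hz],
        by simp [hzu, hz], by omega⟩
    obtain rfl : n = 0 := by simpa using hn.symm
    refine ⟨μ', .seq (.assign _ _ _) hex, h₁, h₂, h₃, ?_⟩
    rw [hd, ← hnd, Nat.zero_add]
  have exec_exp : ∀ (μ : Store V A) (t : ℕ), μ o = [] → μ y = List.replicate t 1 →
      ∃ μ', Exec μ exp .top μ' ∧ μ' o = [] ∧ μ' x = μ x ∧ μ' y = List.replicate (2 ^ t) 1 := by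
    intro μ t ho hy
    obtain ⟨μ', hex, h₁, h₂, n, c, hn, hc, hnc⟩ := exec_countdown (x := y) (pred := pred y)
      (guard := guard y o) (s := double)
      (fun w ν => ν o = [] ∧ ν x = μ x ∧ ∃ n c,
        w = List.replicate n 1 ∧ ν z = List.replicate c 1 ∧ c * 2 ^ n = 2 ^ t)
      (fun w ν h hw => by rw [hguard, hw, h.1]) (hpred y)
      (by
        rintro w ν hw ⟨h₁, h₂, n, c, rfl, hc, hnc⟩
        obtain ⟨n, rfl⟩ := Nat.exists_eq_succ_of_ne_zero (n := n) (by rintro rfl; exact hw rfl)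
        obtain ⟨ν', hex, k₁, k₂, k₃, k₄⟩ := exec_double
          (Function.update ν y (unaryPred (List.replicate (n + 1) 1))) c
          (by simp [hyo.symm, h₁]) (by simp [hyz.symm, hc])
        refine ⟨ν', hex, by simp [k₃], k₁, by simp [k₂, hxy, h₂], n, 2 * c,
          unaryPred_replicate n, k₄, ?_⟩
        rw [← hnc, pow_succ]
        ring)
      _ (Function.update μ z (unarySucc (μ o))) rfl
      ⟨by simp [hzo.symm, ho], by simp [hxz], t, 1, by simp [hyz, hy],
        by simpa [ho] using unarySucc_replicate (A := A) 0, by simp⟩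
    obtain rfl : n = 0 := by simpa using hn.symm
    refine ⟨Function.update μ' y (μ' z), .seq (μ' := Function.update μ z (unarySucc (μ o))) ?_
      (.seq hex (.assign _ _ _)), by simp [hyo.symm, h₁], by simp [hxy, h₂], ?_⟩
    · rw [← hsucc]
      exact .assign _ _ _
    · rw [Function.update_self, hc, ← hnc, pow_zero, mul_one]
  have exec_all : ∀ μ : Store V A, μ o = [] → μ y = [] → ∃ μ', Exec μ (down x exp) .top μ' ∧
      ∀ n, μ x = List.replicate n 1 → (μ' y).length = tower n 0 := by
    intro μ ho hy
    obtain ⟨μ', hex, h₁, t, ht, h⟩ := exec_countdown (x := x) (pred := pred x)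
      (guard := guard x o) (s := exp)
      -- The input need not be unary; the invariant then only says that `y` is.
      (fun w ν => ν o = [] ∧ ∃ t, ν y = List.replicate t 1 ∧ ∀ n, μ x = List.replicate n 1 →
        ∃ a, w = List.replicate a 1 ∧ tower a t = tower n 0)
      (fun w ν h hw => by rw [hguard, hw, h.1]) (hpred x)
      (by
        rintro w ν hw ⟨h₁, t, ht, h⟩
        obtain ⟨ν', hex, k₁, k₂, k₃⟩ := exec_exp (Function.update ν x (unaryPred w)) t
          (by simp [hxo.symm, h₁]) (by simp [hxy.symm, ht])
        refine ⟨ν', hex, by simp [k₂], k₁, 2 ^ t, k₃, fun n hn => ?_⟩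
        obtain ⟨a, rfl, ha⟩ := h n hn
        obtain ⟨a, rfl⟩ := Nat.exists_eq_succ_of_ne_zero (n := a) (by rintro rfl; exact hw rfl)
        exact ⟨a, unaryPred_replicate a, ha⟩)
      _ μ rfl ⟨ho, 0, hy, fun n hn => ⟨n, hn, rfl⟩⟩
    refine ⟨μ', hex, fun n hn => ?_⟩
    obtain ⟨a, ha, hat⟩ := h n hn
    obtain rfl : a = 0 := by simpa using ha.symm
    rw [ht, List.length_replicate]
    exact hat
  have hempty : ∀ (w : Fin [x].length → Word A) (a : V), a ≠ x →
      Store.updates [x] w (Store.empty V A) a = [] := by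
    intro w a ha
    simp [Store.updates, Store.empty, ha]
  refine ⟨⟨[x], down x exp, y, trivial⟩, fun w => ?_, rfl, fun w n hw v hv => ?_⟩
  · obtain ⟨μ', hex, -⟩ := exec_all _ (hempty w o hxo.symm) (hempty w y hxy.symm)
    exact ⟨_, μ', hex, rfl⟩
  · obtain ⟨μ', hex, h⟩ := exec_all _ (hempty w o hxo.symm) (hempty w y hxy.symm)
    obtain ⟨μ'', hex', rfl⟩ := hv
    rw [← (hex.unique hex').2]
    refine h n ?_
    simpa [Store.updates] using hw 0

end Declass

theorem mainTheorem8 {A : Type} [Finite A] [LinearOrder A] [Zero A] [One A] [NeZero (1 : A)]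
    {V : Type} [DecidableEq V] [Infinite V] (O : Declass.OpSet A) (hO : O.IncludesBasic) :
    Declass.SAFE V O ∩ Declass.AP V O ⊆ Declass.TERM V O ∧
    Declass.functionsOf (Declass.SAFE V O ∩ Declass.AP V O) ⊂
      Declass.functionsOf (Declass.TERM V O) := by
  have hterm : Declass.SAFE V O ∩ Declass.AP V O ⊆ Declass.TERM V O := by
    intro P hP w
    obtain ⟨k, hk⟩ := Declass.exists_returns_length_le_tower hP
    obtain ⟨v, hv, -⟩ := hk w
    exact ⟨v, hv⟩
  refine ⟨hterm, Set.image_mono hterm, fun hsub => ?_⟩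
  obtain ⟨P, hP, hlen, hret⟩ := Declass.exists_terminating_tower (V := V) O hO
  obtain ⟨k, hk⟩ := Declass.exists_length_le_tower_of_mem_functionsOf
    (hsub (Set.mem_image_of_mem _ hP))
  obtain ⟨n, hn⟩ := Declass.exists_tower_lt_tower_zero k
  obtain ⟨v, hv, hle⟩ := hk fun _ => List.replicate n 1
  have hv' := hret _ n (fun _ => rfl) v ((P.mem_sem_iff _ v).1 hv)
  have hmax : Declass.maxLen (fun _ : Fin P.params.length => List.replicate n (1 : A)) ≤ n :=
    Declass.maxLen_le fun _ => List.length_replicate.le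
  exact hn.not_ge (hv'.ge.trans (hle.trans ((Declass.tower_strictMono k).monotone hmax)))
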